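/- Let $(S_0,\gamma)$ be a smooth connected Riemannian manifold, $\bm s$ a smooth one-form and $h$ a smooth function on $S_0$. (These are the data induced on any cut $S_0\subset\{u=0\}$ of the horizon of the near horizon geometry $g = 2\,dv\,(du + 2u\, s_A dx^A + \tfrac12 u^2 h\, dv) + \gamma_{AB}\,dx^A dx^B$.) For a smooth function $f:S_0\to\mathbb R$ with $df$ nowhere zero, put $N := \gamma^\sharp(df,df)$. Call $f$ a potential of a smooth vector field $\varsigma$ on $S_0$ if $df$ is nowhere zero and there are smooth functions $Q,P$ on $f(S_0)\subset\mathbb R$, with $Q$ not identically zero, such that $$\frac{dQ}{df} = QP,\qquad \frac{d}{df}\Big(\frac{dP}{df}+P^2\Big)+P\Big(\frac{dP}{df}+P^2\Big)=0,$$ $$\gamma(\varsigma,\cdot)=\frac{Q(f)}{N}\,df,\qquad \bm s=\frac12\Big(\frac{dN}{N}-P(f)\,df\Big),\qquad h=\frac12 N\Big(\frac{dP}{df}+P^2\Big)(f).$$ Let $\mathcal K_{S_0}$ be the set of smooth vector fields on $S_0$ that are Killing vectors of $(S_0,\gamma)$ and are either zero or have a potential (with the given $\bm s$ and $h$). Then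 $\mathcal K_{S_0}$ is a vector space, i.e. a real linear subspace of the space of smooth vector fields on $S_0$, and every $\varsigma\in\mathcal K_{S_0}$ is a hypersurface-orthogonal Killing vector of $(S_0,\gamma)$: it is Killing, and $\bm\varsigma:=\gamma(\varsigma,\cdot)$ satisfies $\bm\varsigma\wedge d\bm\varsigma=0$. Moreover, if $\varsigma_1,\varsigma_2\in\mathcal K_{S_0}$ are linearly independent, then both have potentials, and for all potentials $f_1$ of $\varsigma_1$ and $f_2$ of $\varsigma_2$ one has $df_1\wedge df_2\neq 0$ at every point of $S_0$. -/

import Mathlib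

open scoped Manifold ContDiff

/-- The space `𝔛(S)` of smooth vector fields on a smooth `d`-dimensional manifold `S`. -/
abbrev SmoothVectorField (d : ℕ) (S : Type*) [TopologicalSpace S]
    [ChartedSpace (EuclideanSpace ℝ (Fin d)) S] [IsManifold (𝓡 d) ∞ S] :=
  ContMDiffSection (𝓡 d) (EuclideanSpace ℝ (Fin d)) ∞
    (fun p : S => TangentSpace (𝓡 d) p)

/-- The data on a cut `S` of the horizon `{u = 0}` of a near horizon geometry
`g = 2 dv (du + 2 u s_A dx^A + (1/2) u² h dv) + γ_{AB} dx^A dx^B`: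
a smooth Riemannian metric `γ`, a smooth one-form `s` (the torsion one-form) and a smooth
function `h`. The data do not depend on `v`, so they are the same on every cut, and every such
triple arises from a near horizon geometry, namely the one given by the displayed formula. -/
structure NearHorizonData (d : ℕ) (S : Type*) [TopologicalSpace S]
    [ChartedSpace (EuclideanSpace ℝ (Fin d)) S] [IsManifold (𝓡 d) ∞ S] where
  /-- the Riemannian metric of the cut -/
  γ : Bundle.ContMDiffRiemannianMetric (𝓡 d) ∞ (EuclideanSpace ℝ (Fin d))
    (fun p : S => TangentSpace (𝓡 d) p)
  /-- the torsion one-form -/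
  s : ∀ p : S, TangentSpace (𝓡 d) p →L[ℝ] ℝ
  /-- the torsion one-form is smooth, as a section of the cotangent bundle -/
  contMDiff_s : ContMDiff (𝓡 d) ((𝓡 d).prod 𝓘(ℝ, EuclideanSpace ℝ (Fin d) →L[ℝ] ℝ)) ∞
    (fun p => Bundle.TotalSpace.mk' (EuclideanSpace ℝ (Fin d) →L[ℝ] ℝ)
      (E := fun p : S => TangentSpace (𝓡 d) p →L[ℝ] ℝ) p (s p))
  /-- the metric coefficient `h` -/
  h : S → ℝ
  contMDiff_h : ContMDiff (𝓡 d) 𝓘(ℝ, ℝ) ∞ h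

/-- The wedge product of two covectors, `(α ∧ β)(v, w) = α(v) β(w) - α(w) β(v)`. -/
def wedgeCovectors {V : Type*} [TopologicalSpace V] [AddCommGroup V] [Module ℝ V]
    (α β : V →L[ℝ] ℝ) : V → V → ℝ :=
  fun v w => α v * β w - α w * β v

section

variable {d : ℕ} {S : Type*} [TopologicalSpace S]
  [ChartedSpace (EuclideanSpace ℝ (Fin d)) S] [IsManifold (𝓡 d) ∞ S]

/-- `X` is a vector field that is smooth near the point `p`. -/
def SmoothFieldAt (X : ∀ q : S, TangentSpace (𝓡 d) q) (p : S) : Prop :=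
  ContMDiffAt (𝓡 d) (𝓡 d).tangent ∞ (fun q => (X q : TangentBundle (𝓡 d) S)) p

/-- The exterior derivative of a one-form `α`, evaluated on two vector fields at `p`:
`dα(X, Y) = X(α(Y)) - Y(α(X)) - α([X, Y])`. -/
noncomputable def extDerivOneForm (α : ∀ q : S, TangentSpace (𝓡 d) q →L[ℝ] ℝ)
    (X Y : ∀ q : S, TangentSpace (𝓡 d) q) (p : S) : ℝ :=
  mvfderiv (𝓡 d) (fun q => α q (Y q)) p (X p) - mvfderiv (𝓡 d) (fun q => α q (X q)) p (Y p)
    - α p (VectorField.mlieBracket (𝓡 d) X Y p)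

namespace NearHorizonData

/-- The one-form `γ(ς, ·)` metrically related to a vector field `ς`. -/
noncomputable def lower (D : NearHorizonData d S) (ς : SmoothVectorField d S) (p : S) :
    TangentSpace (𝓡 d) p →L[ℝ] ℝ :=
  D.γ.inner p (ς p)

/-- The Lie derivative of the metric, evaluated on two vector fields at `p`:
`(L_ς γ)(X, Y) = ς(γ(X, Y)) - γ([ς, X], Y) - γ(X, [ς, Y])`. -/
noncomputable def lieDerivMetric (D : NearHorizonData d S) (ς : SmoothVectorField d S)
    (X Y : ∀ q : S, TangentSpace (𝓡 d) q) (p : S) : ℝ :=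
  mvfderiv (𝓡 d) (fun q => D.γ.inner q (X q) (Y q)) p (ς p)
    - D.γ.inner p (VectorField.mlieBracket (𝓡 d) (fun q => ς q) X p) (Y p)
    - D.γ.inner p (X p) (VectorField.mlieBracket (𝓡 d) (fun q => ς q) Y p)

/-- `ς` is a Killing vector field of `(S, γ)`: `L_ς γ = 0`. -/
def IsKilling (D : NearHorizonData d S) (ς : SmoothVectorField d S) : Prop :=
  ∀ (p : S) (X Y : ∀ q : S, TangentSpace (𝓡 d) q),
    SmoothFieldAt X p → SmoothFieldAt Y p → D.lieDerivMetric ς X Y p = 0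

/-- `ς` is hypersurface-orthogonal: the one-form `α = γ(ς, ·)` satisfies `α ∧ dα = 0`. -/
def IsHypersurfaceOrthogonal (D : NearHorizonData d S) (ς : SmoothVectorField d S) : Prop :=
  ∀ (p : S) (X Y W : ∀ q : S, TangentSpace (𝓡 d) q),
    SmoothFieldAt X p → SmoothFieldAt Y p → SmoothFieldAt W p →
    D.lower ς p (X p) * extDerivOneForm (D.lower ς) Y W p
      + D.lower ς p (Y p) * extDerivOneForm (D.lower ς) W X p
      + D.lower ς p (W p) * extDerivOneForm (D.lower ς) X Y p = 0

/-- The metric at a point as a bilinear form. -/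
noncomputable def bilin (D : NearHorizonData d S) (p : S) :
    LinearMap.BilinForm ℝ (TangentSpace (𝓡 d) p) :=
  LinearMap.mk₂ ℝ (fun v w => D.γ.inner p v w) (by simp) (by simp) (by simp) (by simp)

theorem bilin_nondegenerate (D : NearHorizonData d S) (p : S) : (D.bilin p).Nondegenerate := by
  constructor
  · intro v hv
    by_contra hne
    exact (D.γ.pos p v hne).ne' (hv v)
  · intro v hv
    by_contra hne
    exact (D.γ.pos p v hne).ne' (hv v)

/-- The gradient of `f`: the vector field with `γ(grad f, ·) = df`. -/
noncomputable def grad (D : NearHorizonData d S) (f : S → ℝ) (p : S) : TangentSpace (𝓡 d) p :=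
  haveI : FiniteDimensional ℝ (TangentSpace (𝓡 d) p) :=
    inferInstanceAs (FiniteDimensional ℝ (EuclideanSpace ℝ (Fin d)))
  ((D.bilin p).toDual (D.bilin_nondegenerate p)).symm (mvfderiv (𝓡 d) f p).toLinearMap

theorem inner_grad (D : NearHorizonData d S) (f : S → ℝ) (p : S) (v : TangentSpace (𝓡 d) p) :
    D.γ.inner p (D.grad f p) v = mvfderiv (𝓡 d) f p v := by
  have : FiniteDimensional ℝ (TangentSpace (𝓡 d) p) :=
    inferInstanceAs (FiniteDimensional ℝ (EuclideanSpace ℝ (Fin d)))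
  exact LinearMap.BilinForm.apply_toDual_symm_apply (hB := D.bilin_nondegenerate p)
    (f := (mvfderiv (𝓡 d) f p).toLinearMap) v

/-- `N = γ^♯(df, df)`, the square norm of the differential of `f`. -/
noncomputable def normSqDiff (D : NearHorizonData d S) (f : S → ℝ) (p : S) : ℝ :=
  mvfderiv (𝓡 d) f p (D.grad f p)

/-- The smooth function `f`, with the functions `Q` and `P` of one real variable, represents the
vector field `ς`. Here `Q` and `P` are smooth functions of the values of `f`. -/
structure Represents (D : NearHorizonData d S) (ς : SmoothVectorField d S) (f : S → ℝ)
    (Q P : ℝ → ℝ) : Prop where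
  smooth_f : ContMDiff (𝓡 d) 𝓘(ℝ, ℝ) ∞ f
  /-- `df` vanishes nowhere -/
  df_ne_zero : ∀ p, mvfderiv (𝓡 d) f p ≠ 0
  smooth_Q : ContDiffOn ℝ ∞ Q (Set.range f)
  smooth_P : ContDiffOn ℝ ∞ P (Set.range f)
  /-- `Q` is not identically zero -/
  Q_ne_zero : ∃ t ∈ Set.range f, Q t ≠ 0
  /-- `Q' = Q P` -/
  ode_Q : ∀ t ∈ Set.range f, deriv Q t = Q t * P t
  /-- `(P' + P²)' + P (P' + P²) = 0` -/
  ode_P : ∀ t ∈ Set.range f,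
    deriv (fun x => deriv P x + P x ^ 2) t + P t * (deriv P t + P t ^ 2) = 0
  /-- `γ(ς, ·) = (Q(f) / N) df` -/
  form_eq : ∀ p, D.lower ς p = (Q (f p) / D.normSqDiff f p) • mvfderiv (𝓡 d) f p
  /-- `s = (1/2) (dN / N - P(f) df)` -/
  s_eq : ∀ p, D.s p = (1 / 2 : ℝ) •
    ((1 / D.normSqDiff f p) • mvfderiv (𝓡 d) (D.normSqDiff f) p - P (f p) • mvfderiv (𝓡 d) f p)
  /-- `h = (1/2) N (P'(f) + P(f)²)` -/
  h_eq : ∀ p, D.h p = 1 / 2 * D.normSqDiff f p * (deriv P (f p) + P (f p) ^ 2)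

/-- `f` is a potential of the vector field `ς`. -/
def IsPotential (D : NearHorizonData d S) (ς : SmoothVectorField d S) (f : S → ℝ) : Prop :=
  ∃ Q P : ℝ → ℝ, D.Represents ς f Q P

/-- The collection of Killing vector fields of `(S, γ)` that are zero (the trivial element, the
case `df = 0`) or have a potential. -/
def killingCollection (D : NearHorizonData d S) : Set (SmoothVectorField d S) :=
  {ς | D.IsKilling ς ∧ (ς = 0 ∨ ∃ f : S → ℝ, D.IsPotential ς f)}

end NearHorizonData

end

/-! The defining equations become linear in the field after the substitution `E = N / Q(f)`. Since
`N = Q(f) E`, the formula for `s` says `dE = 2 E s`, so on a connected manifold `s` alone fixes `E`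
up to a constant factor, whatever the field. The formula for `γ(ς, ·)` says that `df = E γ(ς, ·)`.
The equations for `Q` and `P` make `c = Q (P' + P²) / 2` constant, so `h = c E`, and they give `(Q P
/ 2)' = c`. For a Killing field `s(ς) = Q P / 2`, hence `s(ς) = c f + b`. With one `E` and its `c`
fixed, the conditions "Killing, `E γ(ς, ·) = dg`, `s(ς) = c g + b`" (`IsAdapted`) define a linear
space.

Conversely, an adapted field satisfies `d(dg(ς)) = 2 s(ς) dg`, so `dg(ς)` is a quadratic polynomial
`Q` in `g`; then `g` is a potential with `P = Q' / Q`, provided `Q(g)` has no zero. This holds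
because a nonzero adapted field vanishes nowhere: at a zero, after normalising `g` to vanish there,
`E |ς|² = c g²`, so `dg` is bounded by a multiple of `g` and Grönwall forces `g = 0`.

Hypersurface-orthogonality follows from `d(E γ(ς, ·)) = 0`. If `df₁ ∧ df₂` vanishes at a point, a
nontrivial combination of the two fields vanishes there, hence everywhere. -/

open Set Filter Topology

/-! ### Second derivatives of a function along vector fields -/

section
variable {d : ℕ} {S : Type*} [TopologicalSpace S]
  [ChartedSpace (EuclideanSpace ℝ (Fin d)) S] [IsManifold (𝓡 d) ∞ S]

/-- The chain rule for a function read in an extended chart. -/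
theorem fderivWithin_comp_extChartAt_symm {g : S → ℝ} (p : S) {y : EuclideanSpace ℝ (Fin d)}
    (hy : y ∈ (extChartAt (𝓡 d) p).target)
    (hg : MDifferentiableAt (𝓡 d) 𝓘(ℝ, ℝ) g ((extChartAt (𝓡 d) p).symm y))
    (v : EuclideanSpace ℝ (Fin d)) :
    fderivWithin ℝ (g ∘ (extChartAt (𝓡 d) p).symm) (range (𝓡 d)) y v =
      mvfderiv (𝓡 d) g ((extChartAt (𝓡 d) p).symm y)
        (mfderivWithin 𝓘(ℝ, EuclideanSpace ℝ (Fin d)) (𝓡 d) (extChartAt (𝓡 d) p).symm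
          (range (𝓡 d)) y v) := by
  have : IsManifold (𝓡 d) 1 S := IsManifold.of_le (n := ∞) (by norm_cast)
  have h := mvfderiv_comp_mfderivWithin (s := range (𝓡 d)) y hg
    (mdifferentiableWithinAt_extChartAt_symm hy)
    ((𝓡 d).uniqueDiffOn.uniqueMDiffOn y (extChartAt_target_subset_range p hy))
  have h2 : mvfderivWithin 𝓘(ℝ, EuclideanSpace ℝ (Fin d)) (g ∘ (extChartAt (𝓡 d) p).symm)
      (range (𝓡 d)) y = fderivWithin ℝ (g ∘ (extChartAt (𝓡 d) p).symm) (range (𝓡 d)) y := by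
    rw [← mfderivWithin_eq_fderivWithin]
    rfl
  rw [← h2, h]
  rfl

/-- The second exterior derivative of a function vanishes: `X(Yg) - Y(Xg) = [X, Y]g`. -/
theorem mvfderiv_mlieBracket {g : S → ℝ} {X Y : ∀ q : S, TangentSpace (𝓡 d) q} {p : S}
    (hg : ContMDiff (𝓡 d) 𝓘(ℝ, ℝ) ∞ g) (hX : SmoothFieldAt X p) (hY : SmoothFieldAt Y p)
    (hgX : MDifferentiableAt (𝓡 d) 𝓘(ℝ, ℝ) (fun q => mvfderiv (𝓡 d) g q (X q)) p)
    (hgY : MDifferentiableAt (𝓡 d) 𝓘(ℝ, ℝ) (fun q => mvfderiv (𝓡 d) g q (Y q)) p) :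
    mvfderiv (𝓡 d) g p (VectorField.mlieBracket (𝓡 d) X Y p) =
      mvfderiv (𝓡 d) (fun q => mvfderiv (𝓡 d) g q (Y q)) p (X p) -
        mvfderiv (𝓡 d) (fun q => mvfderiv (𝓡 d) g q (X q)) p (Y p) := by
  have : IsManifold (𝓡 d) 2 S := IsManifold.of_le (n := ∞) (by norm_cast)
  have : IsManifold (𝓡 d) 1 S := IsManifold.of_le (n := ∞) (by norm_cast)
  set φ := extChartAt (𝓡 d) p with hφ
  have hpt : φ p ∈ φ.target := mem_extChartAt_target p
  set R : Set (EuclideanSpace ℝ (Fin d)) := range (𝓡 d) with hR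
  -- Differentiating along a field commutes with passing to the chart, so the identity reduces to
  -- one in Euclidean space.
  have hread : ∀ Z : ∀ q : S, TangentSpace (𝓡 d) q, ∀ y ∈ φ.target,
      fderivWithin ℝ (g ∘ φ.symm) R y
        (VectorField.mpullbackWithin 𝓘(ℝ, EuclideanSpace ℝ (Fin d)) (𝓡 d) φ.symm Z R y) =
      mvfderiv (𝓡 d) g (φ.symm y) (Z (φ.symm y)) := by
    intro Z y hy
    refine (fderivWithin_comp_extChartAt_symm p hy (hg.mdifferentiable (by simp) _) _).trans ?_
    congr 1
    exact (isInvertible_mfderivWithin_extChartAt_symm hy).self_apply_inverse _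
  have hid : ∀ v : EuclideanSpace ℝ (Fin d),
      (ContinuousLinearMap.id ℝ (EuclideanSpace ℝ (Fin d))).inverse v = v := by
    intro v
    rw [ContinuousLinearMap.inverse_id]
    rfl
  have hval : ∀ Z : ∀ q : S, TangentSpace (𝓡 d) q,
      VectorField.mpullbackWithin 𝓘(ℝ, EuclideanSpace ℝ (Fin d)) (𝓡 d) φ.symm Z R (φ p) = Z p := by
    intro Z
    rw [VectorField.mpullbackWithin_apply, mfderivWithin_range_extChartAt_symm]
    exact (hid _).trans <| congrArg (fun q : S => (show EuclideanSpace ℝ (Fin d) from Z q)) (extChartAt_to_inv p)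
  have hd : ∀ u : S → ℝ, MDifferentiableAt (𝓡 d) 𝓘(ℝ, ℝ) u p → mvfderiv (𝓡 d) u p =
      fderivWithin ℝ (u ∘ φ.symm) R (φ p) := fun u hu => hu.mvfderiv
  have hder : ∀ Z W : ∀ q : S, TangentSpace (𝓡 d) q,
      MDifferentiableAt (𝓡 d) 𝓘(ℝ, ℝ) (fun q => mvfderiv (𝓡 d) g q (Z q)) p →
      mvfderiv (𝓡 d) (fun q => mvfderiv (𝓡 d) g q (Z q)) p (W p) =
      fderivWithin ℝ (fun y => fderivWithin ℝ (g ∘ φ.symm) R y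
        (VectorField.mpullbackWithin 𝓘(ℝ, EuclideanSpace ℝ (Fin d)) (𝓡 d) φ.symm Z R y)) R (φ p)
        (VectorField.mpullbackWithin 𝓘(ℝ, EuclideanSpace ℝ (Fin d)) (𝓡 d) φ.symm W R (φ p)) := by
    intro Z W hZ
    rw [hd _ hZ, hval]
    have : (fun y => fderivWithin ℝ (g ∘ φ.symm) R y
        (VectorField.mpullbackWithin 𝓘(ℝ, EuclideanSpace ℝ (Fin d)) (𝓡 d) φ.symm Z R y))
        =ᶠ[𝓝[R] (φ p)] (fun q => mvfderiv (𝓡 d) g q (Z q)) ∘ φ.symm := by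
      filter_upwards [extChartAt_target_mem_nhdsWithin p] with y hy using hread Z y hy
    rw [this.fderivWithin_eq (hread Z _ hpt)]
    rfl
  rw [hder Y X hgY, hder X Y hgX, hd g (hg.mdifferentiable (by simp) p),
    ← VectorField.mlieBracketWithin_univ, VectorField.mlieBracketWithin_apply,
    mfderiv_extChartAt_self]
  have hX' := (hX.mdifferentiableAt (by simp)).mdifferentiableWithinAt (s := univ)
    |>.differentiableWithinAt_mpullbackWithin_vectorField
  have hY' := (hY.mdifferentiableAt (by simp)).mdifferentiableWithinAt (s := univ)
    |>.differentiableWithinAt_mpullbackWithin_vectorField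
  simp only [preimage_univ, univ_inter] at hX' hY' ⊢
  have hgR : ContDiffWithinAt ℝ ∞ (g ∘ φ.symm) R (φ p) :=
    ((contMDiffAt_iff_of_mem_source (mem_chart_source _ p) (mem_chart_source _ _)).1 (hg p)).2
  -- This is the symmetry of the second derivative of `g` read in the chart.
  have := VectorField.fderivWithin_apply_lieBracket hgR (by simpa using by norm_cast) (𝓡 d).uniqueDiffOn
    (by simp [hR]) (by simp [hR]) hY' hX'
  exact (congrArg _ (hid _)).trans this
end

/-! ### Coordinate fields and Grönwall's inequality on a connected manifold -/

section
variable {d : ℕ} {S : Type*} [TopologicalSpace S]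
  [ChartedSpace (EuclideanSpace ℝ (Fin d)) S] [IsManifold (𝓡 d) ∞ S]

/-- The vector field near `p` whose components in the chart at `p` are the constants `v`. -/
noncomputable def chartField (p : S) (v : EuclideanSpace ℝ (Fin d)) (q : S) :
    TangentSpace (𝓡 d) q :=
  haveI : IsManifold (𝓡 d) 1 S := IsManifold.of_le (n := ∞) (by norm_cast)
  (trivializationAt (EuclideanSpace ℝ (Fin d)) (TangentSpace (𝓡 d)) p).symmL ℝ q v

theorem smoothFieldAt_chartField (p : S) (v : EuclideanSpace ℝ (Fin d)) {q : S}
    (hq : q ∈ (chartAt (EuclideanSpace ℝ (Fin d)) p).source) :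
    SmoothFieldAt (chartField p v) q := by
  have : IsManifold (𝓡 d) 1 S := IsManifold.of_le (n := ∞) (by norm_cast)
  have : IsManifold (𝓡 d) (∞ + 1) S := IsManifold.of_le (n := ∞) (by norm_cast)
  set t := trivializationAt (EuclideanSpace ℝ (Fin d)) (TangentSpace (𝓡 d) (M := S)) p with ht
  have hq' : q ∈ t.baseSet := by simpa [ht] using hq
  have := TangentBundle.contMDiffVectorBundle (n := ∞) (I := 𝓡 d) (M := S)
  refine (t.contMDiffAt_section_iff (IB := 𝓡 d) (n := ∞) (s := chartField p v) hq').2 ?_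
  refine (contMDiffAt_const (c := v)).congr_of_eventuallyEq ?_
  filter_upwards [t.open_baseSet.mem_nhds hq'] with x hx
  have h : chartField p v x = t.symm x v := t.symmL_apply (R := ℝ) hx v
  rw [h, t.apply_mk_symm hx]

theorem mvfderiv_chartField {u : S → ℝ} (p : S) (v : EuclideanSpace ℝ (Fin d))
    {y : EuclideanSpace ℝ (Fin d)} (hy : y ∈ (extChartAt (𝓡 d) p).target)
    (hu : MDifferentiableAt (𝓡 d) 𝓘(ℝ, ℝ) u ((extChartAt (𝓡 d) p).symm y)) :
    mvfderiv (𝓡 d) u ((extChartAt (𝓡 d) p).symm y)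
      (chartField p v ((extChartAt (𝓡 d) p).symm y)) =
      fderivWithin ℝ (u ∘ (extChartAt (𝓡 d) p).symm) (range (𝓡 d)) y v := by
  have : IsManifold (𝓡 d) 1 S := IsManifold.of_le (n := ∞) (by norm_cast)
  have hs : (extChartAt (𝓡 d) p).symm y ∈ (chartAt (EuclideanSpace ℝ (Fin d)) p).source := by
    simpa only [extChartAt_source] using (extChartAt (𝓡 d) p).map_target hy
  rw [fderivWithin_comp_extChartAt_symm p hy hu]
  have h := TangentBundle.symmL_trivializationAt (I := 𝓡 d) hs
  rw [(extChartAt (𝓡 d) p).right_inv hy] at h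
  have h' := congrArg (fun L => mvfderiv (𝓡 d) u ((extChartAt (𝓡 d) p).symm y) (L v)) h
  exact h'

/-- A function on a connected manifold whose differential is bounded, along the coordinate fields
of each chart, by a continuous multiple of the function vanishes identically as soon as it vanishes
at one point. -/
theorem eq_zero_of_mvfderiv_le [ConnectedSpace S] {u : S → ℝ}
    (hu : ContMDiff (𝓡 d) 𝓘(ℝ, ℝ) ∞ u)
    (hb : ∀ (p : S) (v : EuclideanSpace ℝ (Fin d)), ∃ B : S → ℝ,
      ContinuousOn B (chartAt (EuclideanSpace ℝ (Fin d)) p).source ∧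
      ∀ q ∈ (chartAt (EuclideanSpace ℝ (Fin d)) p).source,
        |mvfderiv (𝓡 d) u q (chartField p v q)| ≤ B q * |u q|)
    {p₀ : S} (h₀ : u p₀ = 0) (q : S) : u q = 0 := by
  -- Only openness of the zero set needs work: points near a zero are joined to it by a coordinate
  -- segment, along which Grönwall's inequality applies.
  have hclopen : IsClopen {q | u q = 0} := by
    refine ⟨isClosed_eq hu.continuous continuous_const, ?_⟩
    rw [isOpen_iff_mem_nhds]
    intro p hp
    set φ := extChartAt (𝓡 d) p with hφ
    obtain ⟨r, hr, hball⟩ := Metric.isOpen_iff.1 (isOpen_extChartAt_target (I := 𝓡 d) p) (φ p)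
      (mem_extChartAt_target p)
    have hnear : ∀ᶠ x in 𝓝 p, φ x ∈ Metric.ball (φ p) r :=
      (continuousAt_extChartAt p).eventually (Metric.ball_mem_nhds _ hr)
    filter_upwards [hnear, extChartAt_source_mem_nhds (I := 𝓡 d) p] with x hx hxs
    set v := φ x - φ p with hv
    obtain ⟨B, hB, hBu⟩ := hb p v
    have hmem : ∀ t ∈ Icc (0 : ℝ) 1, φ p + t • v ∈ φ.target := by
      intro t ht
      apply hball
      have := (convex_ball (φ p) r).add_smul_sub_mem (Metric.mem_ball_self hr) hx ht
      simpa [hv] using this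
    have hsrc : ∀ t ∈ Icc (0 : ℝ) 1,
        φ.symm (φ p + t • v) ∈ (chartAt (EuclideanSpace ℝ (Fin d)) p).source := by
      intro t ht
      simpa only [hφ, extChartAt_source] using φ.map_target (hmem t ht)
    have hcurve : ContinuousOn (fun t : ℝ => φ.symm (φ p + t • v)) (Icc 0 1) :=
      (continuousOn_extChartAt_symm (I := 𝓡 d) p).comp (by fun_prop) hmem
    obtain ⟨K, hK⟩ := isCompact_Icc.bddAbove_image (hB.comp hcurve hsrc)
    have hder : ∀ t ∈ Icc (0 : ℝ) 1, HasDerivAt (fun t : ℝ => u (φ.symm (φ p + t • v)))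
        (mvfderiv (𝓡 d) u (φ.symm (φ p + t • v)) (chartField p v (φ.symm (φ p + t • v)))) t := by
      intro t ht
      have hdiff : DifferentiableAt ℝ (u ∘ φ.symm) (φ p + t • v) := by
        have h1 : ContMDiffOn 𝓘(ℝ, EuclideanSpace ℝ (Fin d)) (𝓡 d) ∞ φ.symm φ.target :=
          contMDiffOn_extChartAt_symm p
        have h2 := hu.comp_contMDiffOn h1
        exact ((h2.contDiffOn.differentiableOn (by simp)) _ (hmem t ht)).differentiableAt
          ((isOpen_extChartAt_target (I := 𝓡 d) p).mem_nhds (hmem t ht))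
      have h3 : HasDerivAt (fun t : ℝ => φ p + t • v) v t := by
        simpa using ((hasDerivAt_id t).smul_const v).const_add (φ p)
      have h4 := hdiff.hasFDerivAt.comp_hasDerivAt t h3
      have h5 := mvfderiv_chartField p v (hmem t ht) (hu.mdifferentiable (by simp) _)
      have hrange : range (𝓡 d) = univ := by simp
      rw [h5, hrange, fderivWithin_univ]
      exact h4
    have key := eq_zero_of_abs_deriv_le_mul_abs_self_of_eq_zero_right
      (f := fun t : ℝ => u (φ.symm (φ p + t • v)))
      (f' := fun t => mvfderiv (𝓡 d) u (φ.symm (φ p + t • v))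
        (chartField p v (φ.symm (φ p + t • v)))) (K := K) (a := 0) (b := 1)
      (fun t ht => (hder t ht).continuousAt.continuousWithinAt)
      (fun t ht => (hder t (Ico_subset_Icc_self ht)).hasDerivWithinAt)
      (by simpa [hφ] using hp)
      (fun t ht => by
        have ht' := Ico_subset_Icc_self ht
        refine (hBu _ (hsrc t ht')).trans ?_
        exact mul_le_mul_of_nonneg_right (hK ⟨t, ht', rfl⟩) (abs_nonneg _)) 1 (by simp)
    simpa [hv, φ.left_inv hxs] using key
  have := hclopen.eq_univ ⟨p₀, h₀⟩
  exact (this ▸ mem_univ q : q ∈ {q | u q = 0})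

theorem eq_of_mvfderiv_eq_zero [ConnectedSpace S] {u : S → ℝ}
    (hu : ContMDiff (𝓡 d) 𝓘(ℝ, ℝ) ∞ u) (h : ∀ p, mvfderiv (𝓡 d) u p = 0) (p q : S) :
    u p = u q := by
  have hc : ContMDiff (𝓡 d) 𝓘(ℝ, ℝ) ∞ fun x => u x - u q := hu.sub contMDiff_const
  have h0 : ∀ x, mvfderiv (𝓡 d) (fun x => u x - u q) x = 0 := by
    intro x
    rw [mvfderiv_fun_sub (hu.mdifferentiable (by simp) x) mdifferentiableAt_const, h x,
      mvfderiv_const, sub_zero]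
  refine sub_eq_zero.1 (eq_zero_of_mvfderiv_le hc (fun x v => ⟨0, continuousOn_const, ?_⟩)
    (p₀ := q) (sub_self _) p)
  intro y _
  simp [h0]

end

theorem mvfderiv_comp_of_hasDerivAt {d : ℕ} {S : Type*} [TopologicalSpace S]
    [ChartedSpace (EuclideanSpace ℝ (Fin d)) S] {g : S → ℝ} {k : ℝ → ℝ} {k' : ℝ} {p : S}
    (hg : MDifferentiableAt (𝓡 d) 𝓘(ℝ, ℝ) g p) (hk : HasDerivAt k k' (g p)) :
    mvfderiv (𝓡 d) (fun q => k (g q)) p = k' • mvfderiv (𝓡 d) g p := by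
  have h := (hk.hasFDerivAt.hasMFDerivAt.comp p hg.hasMFDerivAt).mfderiv
  ext v
  have h' := congrArg (fun L => L v) h
  refine Eq.trans (b := mvfderiv (𝓡 d) g p v * k') h' ?_
  simp [mul_comm]

/-! ### Integrating factors, primitives and adapted fields -/

section
variable {d : ℕ} {S : Type*} [TopologicalSpace S]
  [ChartedSpace (EuclideanSpace ℝ (Fin d)) S] [IsManifold (𝓡 d) ∞ S]

namespace NearHorizonData

theorem contMDiffAt_inner (D : NearHorizonData d S) {X Y : ∀ q : S, TangentSpace (𝓡 d) q} {p : S}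
    (hX : SmoothFieldAt X p) (hY : SmoothFieldAt Y p) :
    ContMDiffAt (𝓡 d) 𝓘(ℝ, ℝ) ∞ (fun q => D.γ.inner q (X q) (Y q)) p := by
  have : IsManifold (𝓡 d) 1 S := IsManifold.of_le (n := ∞) (by norm_cast)
  have h : ContMDiffAt (𝓡 d) ((𝓡 d).prod 𝓘(ℝ, ℝ)) ∞
      (fun q => Bundle.TotalSpace.mk' ℝ (E := Bundle.Trivial S ℝ) q
        (D.γ.inner q (X q) (Y q))) p :=
    ContMDiffAt.clm_bundle_apply₂ (F₁ := EuclideanSpace ℝ (Fin d))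
      (F₂ := EuclideanSpace ℝ (Fin d)) D.γ.contMDiff.contMDiffAt hX hY
  rw [Bundle.contMDiffAt_totalSpace] at h
  exact h.2

theorem contMDiffAt_lower (D : NearHorizonData d S) (ς : SmoothVectorField d S)
    {X : ∀ q : S, TangentSpace (𝓡 d) q} {p : S} (hX : SmoothFieldAt X p) :
    ContMDiffAt (𝓡 d) 𝓘(ℝ, ℝ) ∞ (fun q => D.lower ς q (X q)) p :=
  D.contMDiffAt_inner ς.contMDiff.contMDiffAt hX

theorem contMDiff_lower_self (D : NearHorizonData d S) (ς : SmoothVectorField d S) :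
    ContMDiff (𝓡 d) 𝓘(ℝ, ℝ) ∞ (fun q => D.lower ς q (ς q)) :=
  fun _ => D.contMDiffAt_lower ς ς.contMDiff.contMDiffAt

theorem inner_sq_le (D : NearHorizonData d S) (p : S) (v w : TangentSpace (𝓡 d) p) :
    D.γ.inner p v w ^ 2 ≤ D.γ.inner p v v * D.γ.inner p w w := by
  have hnn : ∀ x, 0 ≤ D.bilin p x x := by
    intro x
    by_cases hx : x = 0
    · simp [hx]
    · exact (D.γ.pos p x hx).le
  exact LinearMap.BilinForm.apply_sq_le_of_symm (D.bilin p) hnn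
    ⟨fun x y => D.γ.symm p x y⟩ v w

theorem eq_zero_of_lower_eq_zero (D : NearHorizonData d S) {ς : SmoothVectorField d S} {p : S}
    (h : D.lower ς p = 0) : ς p = 0 := by
  by_contra hne
  have h1 := D.γ.pos p _ hne
  have h2 : D.γ.inner p (ς p) (ς p) = D.lower ς p (ς p) := rfl
  rw [h2, h] at h1
  simp at h1

/-- `E` is a nowhere vanishing smooth function with `dE = 2 E s`. -/
structure IsIntegratingFactor (D : NearHorizonData d S) (E : S → ℝ) : Prop where
  smooth : ContMDiff (𝓡 d) 𝓘(ℝ, ℝ) ∞ E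
  ne_zero : ∀ p, E p ≠ 0
  deriv_eq : ∀ p, mvfderiv (𝓡 d) E p = (2 * E p) • D.s p

/-- `g` is a smooth function with `dg = E γ(ς, ·)`. -/
structure IsPrimitive (D : NearHorizonData d S) (E : S → ℝ) (ς : SmoothVectorField d S)
    (g : S → ℝ) : Prop where
  smooth : ContMDiff (𝓡 d) 𝓘(ℝ, ℝ) ∞ g
  deriv_eq : ∀ p, mvfderiv (𝓡 d) g p = E p • D.lower ς p

variable {D : NearHorizonData d S} {E g : S → ℝ} {ς : SmoothVectorField d S}

namespace IsPrimitive

theorem mvfderiv_apply (hg : D.IsPrimitive E ς g) (p : S) (v : TangentSpace (𝓡 d) p) :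
    mvfderiv (𝓡 d) g p v = E p * D.lower ς p v := by
  rw [hg.deriv_eq]
  rfl

theorem contMDiffAt_mvfderiv (hE : D.IsIntegratingFactor E) (hg : D.IsPrimitive E ς g)
    {X : ∀ q : S, TangentSpace (𝓡 d) q} {p : S} (hX : SmoothFieldAt X p) :
    ContMDiffAt (𝓡 d) 𝓘(ℝ, ℝ) ∞ (fun q => mvfderiv (𝓡 d) g q (X q)) p := by
  simp only [hg.mvfderiv_apply]
  exact hE.smooth.contMDiffAt.mul (D.contMDiffAt_lower ς hX)

theorem mvfderiv_mvfderiv (hE : D.IsIntegratingFactor E) (hg : D.IsPrimitive E ς g)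
    {X : ∀ q : S, TangentSpace (𝓡 d) q} {p : S} (hX : SmoothFieldAt X p)
    (v : TangentSpace (𝓡 d) p) :
    mvfderiv (𝓡 d) (fun q => mvfderiv (𝓡 d) g q (X q)) p v =
      E p * mvfderiv (𝓡 d) (fun q => D.lower ς q (X q)) p v +
        D.lower ς p (X p) * (2 * E p * D.s p v) := by
  simp only [hg.mvfderiv_apply]
  rw [mvfderiv_fun_mul (hE.smooth.mdifferentiable (by simp) p)
    ((D.contMDiffAt_lower ς hX).mdifferentiableAt (by simp)), hE.deriv_eq]
  simp

/-- If `ς` is Killing and `dg = E γ(ς, ·)`, then `d(dg(ς)) = 2 s(ς) dg`. -/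
theorem mvfderiv_apply_self (hE : D.IsIntegratingFactor E) (hg : D.IsPrimitive E ς g)
    (hK : D.IsKilling ς) (p : S) (v : TangentSpace (𝓡 d) p) :
    mvfderiv (𝓡 d) (fun q => mvfderiv (𝓡 d) g q (ς q)) p v =
      2 * D.s p (ς p) * mvfderiv (𝓡 d) g p v := by
  have : IsManifold (𝓡 d) 1 S := IsManifold.of_le (n := ∞) (by norm_cast)
  set X : ∀ q : S, TangentSpace (𝓡 d) q :=
    FiberBundle.extend (EuclideanSpace ℝ (Fin d)) v with hXdef
  have hX : SmoothFieldAt X p :=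
    FiberBundle.contMDiffAt_extend (k := ∞) (𝓡 d) (EuclideanSpace ℝ (Fin d)) v
  have hXp : X p = v := FiberBundle.extend_apply_self ..
  have hς : SmoothFieldAt (fun q => ς q) p := ς.contMDiff.contMDiffAt
  have h1 := mvfderiv_mlieBracket hg.smooth hς hX
    ((hg.contMDiffAt_mvfderiv hE hς).mdifferentiableAt (by simp))
    ((hg.contMDiffAt_mvfderiv hE hX).mdifferentiableAt (by simp))
  -- As `[ς, ς] = 0`, the Killing equation on the pair `(X, ς)` reduces to `ς(γ(ς, X)) = γ(ς, [ς,
  -- X])`.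
  have h2 := hK p X (fun q => ς q) hX hς
  have h3 : (fun q => D.γ.inner q (X q) (ς q)) = fun q => D.lower ς q (X q) :=
    funext fun q => D.γ.symm q _ _
  rw [lieDerivMetric, h3, VectorField.mlieBracket_self, D.γ.symm] at h2
  rw [hg.mvfderiv_mvfderiv hE hX, hg.mvfderiv_apply, hXp] at h1
  rw [hg.mvfderiv_apply]
  have h4 : D.γ.inner p (ς p) (VectorField.mlieBracket (𝓡 d) (fun q => ς q) X p) =
    D.lower ς p (VectorField.mlieBracket (𝓡 d) (fun q => ς q) X p) := rfl
  rw [h4] at h2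
  simp only [Pi.zero_apply, map_zero, sub_zero] at h2
  linear_combination h1 + E p * h2

/-- With `α = γ(ς, ·)`, `d(E α) = 0` and `dE = 2 E s` give `dα = -2 s ∧ α`, whose wedge with `α`
vanishes. -/
theorem isHypersurfaceOrthogonal (hE : D.IsIntegratingFactor E) (hg : D.IsPrimitive E ς g) :
    D.IsHypersurfaceOrthogonal ς := by
  intro p X Y W hX hY hW
  have key : ∀ A B : ∀ q : S, TangentSpace (𝓡 d) q, SmoothFieldAt A p → SmoothFieldAt B p →
      E p * extDerivOneForm (D.lower ς) A B p =
        2 * E p * (D.lower ς p (A p) * D.s p (B p) - D.lower ς p (B p) * D.s p (A p)) := by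
    intro A B hA hB
    have h1 := mvfderiv_mlieBracket hg.smooth hA hB
      ((hg.contMDiffAt_mvfderiv hE hA).mdifferentiableAt (by simp))
      ((hg.contMDiffAt_mvfderiv hE hB).mdifferentiableAt (by simp))
    rw [hg.mvfderiv_mvfderiv hE hA, hg.mvfderiv_mvfderiv hE hB, hg.mvfderiv_apply] at h1
    rw [extDerivOneForm]
    linear_combination (-1 : ℝ) * h1
  apply mul_left_cancel₀ (hE.ne_zero p)
  linear_combination D.lower ς p (X p) * key Y W hY hW + D.lower ς p (Y p) * key W X hW hX
    + D.lower ς p (W p) * key X Y hX hY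

end IsPrimitive

/-- `ς` is Killing, `E γ(ς, ·)` has a primitive `g`, and `s(ς) = c g + b` for a constant `b`. -/
def IsAdapted (D : NearHorizonData d S) (E : S → ℝ) (c : ℝ) (ς : SmoothVectorField d S) : Prop :=
  D.IsKilling ς ∧ ∃ (g : S → ℝ) (b : ℝ), D.IsPrimitive E ς g ∧ ∀ p, D.s p (ς p) = c * g p + b

variable [ConnectedSpace S] {c b : ℝ}

/-- The Killing equation gives `d(dg(ς)) = 2 (c g + b) dg`, which integrates to a quadratic with
constant of integration `a`. -/
theorem IsPrimitive.exists_quadratic (hE : D.IsIntegratingFactor E) (hg : D.IsPrimitive E ς g)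
    (hK : D.IsKilling ς) (hs : ∀ p, D.s p (ς p) = c * g p + b) :
    ∃ a, ∀ p, mvfderiv (𝓡 d) g p (ς p) = c * g p ^ 2 + 2 * b * g p + a := by
  obtain ⟨p₀⟩ := (inferInstance : Nonempty S)
  have hςg : ContMDiff (𝓡 d) 𝓘(ℝ, ℝ) ∞ fun q => mvfderiv (𝓡 d) g q (ς q) :=
    fun p => hg.contMDiffAt_mvfderiv hE ς.contMDiff.contMDiffAt
  have hp : ContMDiff (𝓡 d) 𝓘(ℝ, ℝ) ∞ fun q => c * (g q * g q) + 2 * b * g q :=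
    (contMDiff_const.mul (hg.smooth.mul hg.smooth)).add (contMDiff_const.mul hg.smooth)
  have h0 := eq_of_mvfderiv_eq_zero (hςg.sub hp) (fun p => by
    have hk : HasDerivAt (fun t : ℝ => c * (t * t) + 2 * b * t) (2 * c * g p + 2 * b) (g p) := by
      convert! (((hasDerivAt_id (g p)).mul (hasDerivAt_id (g p))).const_mul c).add
        ((hasDerivAt_id (g p)).const_mul (2 * b)) using 1
      simp
      ring
    have h := mvfderiv_fun_sub (hςg.mdifferentiable (by simp) p) (hp.mdifferentiable (by simp) p)
    rw [mvfderiv_comp_of_hasDerivAt (hg.smooth.mdifferentiable (by simp) p) hk] at h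
    refine h.trans (ContinuousLinearMap.ext fun v => ?_)
    have := hg.mvfderiv_apply_self hE hK p v
    simp only [sub_apply, smul_apply, this, hs, smul_eq_mul,
      zero_apply]
    ring)
  refine ⟨mvfderiv (𝓡 d) g p₀ (ς p₀) - (c * (g p₀ * g p₀) + 2 * b * g p₀), fun p => ?_⟩
  linear_combination h0 p p₀

/-- Shifting `g` to vanish at `p` kills both `b` and `a`, leaving `E |ς|² = c g²`. By
Cauchy–Schwarz, `dg(X)² ≤ E² |ς|² |X|² = c E |X|² g²`, and Grönwall gives `g = 0`. -/
theorem IsAdapted.eq_zero_of_apply_eq_zero (hE : D.IsIntegratingFactor E)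
    (h : D.IsAdapted E c ς) {p : S} (hp : ς p = 0) : ς = 0 := by
  obtain ⟨hK, g, b, hg, hs⟩ := h
  have hu : D.IsPrimitive E ς fun q => g q - g p := by
    refine ⟨hg.smooth.sub contMDiff_const, fun q => ?_⟩
    rw [mvfderiv_fun_sub (hg.smooth.mdifferentiable (by simp) q) mdifferentiableAt_const,
      mvfderiv_const, sub_zero, hg.deriv_eq]
  have hb : c * g p + b = 0 := by rw [← hs p, hp, map_zero]
  have hs' : ∀ q, D.s q (ς q) = c * (g q - g p) + 0 := fun q => by
    rw [hs]
    linear_combination hb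
  obtain ⟨a, ha⟩ := hu.exists_quadratic hE hK hs'
  have ha0 : a = 0 := by
    have := ha p
    rw [hp, map_zero] at this
    linear_combination (-1 : ℝ) * this
  have hzero := eq_zero_of_mvfderiv_le hu.smooth (p₀ := p) (fun x v =>
    ⟨fun q => √|c * E q * D.γ.inner q (chartField x v q) (chartField x v q)|, fun q hq => ?_,
      fun q hq => ?_⟩) (sub_self _)
  · have hd : ∀ q, D.lower ς q = 0 := by
      intro q
      have h1 : (fun q => g q - g p) = fun _ => (0 : ℝ) := funext hzero
      have h2 := hu.deriv_eq q
      rw [h1, mvfderiv_const] at h2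
      exact (smul_eq_zero.1 h2.symm).resolve_left (hE.ne_zero q)
    ext q
    rw [D.eq_zero_of_lower_eq_zero (hd q)]
    rfl
  · have hX := smoothFieldAt_chartField x v hq
    have h1 := (D.contMDiffAt_inner hX hX).continuousAt
    have h2 := hE.smooth.continuous.continuousAt (x := q)
    exact (((continuousAt_const.mul h2).mul h1).abs.sqrt).continuousWithinAt
  · rw [← Real.sqrt_sq_eq_abs (g q - g p), ← Real.sqrt_mul (abs_nonneg _)]
    apply Real.abs_le_sqrt
    have h1 := D.inner_sq_le q (ς q) (chartField x v q)
    have h2 := ha q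
    rw [hu.mvfderiv_apply] at h2 ⊢
    have h3 : D.lower ς q (ς q) = D.γ.inner q (ς q) (ς q) := rfl
    have h4 : D.lower ς q (chartField x v q) = D.γ.inner q (ς q) (chartField x v q) := rfl
    rw [h3] at h2
    rw [h4]
    calc _ = E q ^ 2 * D.γ.inner q (ς q) (chartField x v q) ^ 2 := by ring
      _ ≤ E q ^ 2 * (D.γ.inner q (ς q) (ς q) *
          D.γ.inner q (chartField x v q) (chartField x v q)) :=
        mul_le_mul_of_nonneg_left h1 (sq_nonneg _)
      _ = c * E q * D.γ.inner q (chartField x v q) (chartField x v q) * (g q - g p) ^ 2 := by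
        rw [ha0] at h2
        linear_combination E q * D.γ.inner q (chartField x v q) (chartField x v q) * h2
      _ ≤ _ := mul_le_mul_of_nonneg_right (le_abs_self _) (sq_nonneg _)

end NearHorizonData
end

/-! ### Potentials, Killing fields and the linear space of adapted fields -/

section
variable {d : ℕ} {S : Type*} [TopologicalSpace S]
  [ChartedSpace (EuclideanSpace ℝ (Fin d)) S] [IsManifold (𝓡 d) ∞ S]

/-- A smooth function without critical points has open range. -/
theorem isOpen_range_of_mvfderiv_ne_zero {f : S → ℝ} (hf : ContMDiff (𝓡 d) 𝓘(ℝ, ℝ) ∞ f)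
    (hdf : ∀ p, mvfderiv (𝓡 d) f p ≠ 0) : IsOpen (range f) := by
  rw [isOpen_iff_mem_nhds]
  rintro _ ⟨p, rfl⟩
  set φ := extChartAt (𝓡 d) p with hφ
  have hF : ContDiffAt ℝ ∞ (f ∘ φ.symm) (φ p) := by
    have h1 : ContMDiffOn 𝓘(ℝ, EuclideanSpace ℝ (Fin d)) (𝓡 d) ∞ φ.symm φ.target :=
      contMDiffOn_extChartAt_symm p
    exact (hf.comp_contMDiffOn h1).contDiffOn.contDiffAt
      ((isOpen_extChartAt_target (I := 𝓡 d) p).mem_nhds (mem_extChartAt_target p))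
  have hstrict : HasStrictFDerivAt (f ∘ φ.symm) (fderiv ℝ (f ∘ φ.symm) (φ p)) (φ p) :=
    hF.hasStrictFDerivAt (by simp)
  have hd : mvfderiv (𝓡 d) f p = fderiv ℝ (f ∘ φ.symm) (φ p) := by
    have h := (hf.mdifferentiable (by simp) p).mvfderiv
    rw [show range (𝓡 d) = univ by simp, fderivWithin_univ] at h
    exact h
  have hne : fderiv ℝ (f ∘ φ.symm) (φ p) ≠ 0 := fun h => hdf p (hd.trans h)
  have hsurj : (fderiv ℝ (f ∘ φ.symm) (φ p)).range = ⊤ :=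
    LinearMap.range_eq_top.2 (LinearMap.surjective (f := (fderiv ℝ (f ∘ φ.symm) (φ p)).toLinearMap)
      (fun h => hne (ContinuousLinearMap.coe_injective h)))
  have hmap := hstrict.map_nhds_eq_of_surj hsurj
  have hp : (f ∘ φ.symm) (φ p) = f p := by simp [hφ]
  rw [hp] at hmap
  rw [← hmap]
  exact mem_map.2 (Filter.univ_mem' fun y => mem_range_self (φ.symm y))

/-- A solution of `Q' = Q P` on an interval which is not identically zero vanishes nowhere. -/
theorem ne_zero_of_deriv_eq_mul {T : Set ℝ} (hT : IsOpen T) (hT' : IsPreconnected T) {Q P : ℝ → ℝ}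
    (hQ : DifferentiableOn ℝ Q T) (hP : ContinuousOn P T) (hne : ∃ t ∈ T, Q t ≠ 0)
    (hode : ∀ t ∈ T, deriv Q t = Q t * P t) {t : ℝ} (ht : t ∈ T) : Q t ≠ 0 := by
  intro h0
  obtain ⟨t₁, ht₁, h1⟩ := hne
  have hmem : ∀ x ∈ Icc (0 : ℝ) 1, t + x • (t₁ - t) ∈ T := by
    intro x hx
    exact (isPreconnected_iff_ordConnected.1 hT').convex.add_smul_sub_mem ht ht₁ hx
  have hcont : ContinuousOn (fun x : ℝ => |P (t + x • (t₁ - t)) * (t₁ - t)|) (Icc 0 1) :=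
    ((hP.comp (by fun_prop) hmem).mul continuousOn_const).abs
  obtain ⟨K, hK⟩ := isCompact_Icc.bddAbove_image hcont
  have hder : ∀ x ∈ Icc (0 : ℝ) 1, HasDerivAt (fun x : ℝ => Q (t + x • (t₁ - t)))
      (Q (t + x • (t₁ - t)) * P (t + x • (t₁ - t)) * (t₁ - t)) x := by
    intro x hx
    have h2 := (hQ.differentiableAt (hT.mem_nhds (hmem x hx))).hasDerivAt
    rw [hode _ (hmem x hx)] at h2
    have h3 : HasDerivAt (fun x : ℝ => t + x • (t₁ - t)) (t₁ - t) x := by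
      simpa using ((hasDerivAt_id x).smul_const (t₁ - t)).const_add t
    exact h2.comp x h3
  have := eq_zero_of_abs_deriv_le_mul_abs_self_of_eq_zero_right (K := K)
    (fun x hx => (hder x hx).continuousAt.continuousWithinAt)
    (fun x hx => (hder x (Ico_subset_Icc_self hx)).hasDerivWithinAt)
    (by simpa using h0)
    (fun x hx => by
      rw [mul_assoc, norm_mul, mul_comm]
      exact mul_le_mul_of_nonneg_right (hK ⟨x, Ico_subset_Icc_self hx, rfl⟩) (norm_nonneg _))
    1 (by simp)
  exact h1 (by simpa using this)

namespace NearHorizonData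

variable {D : NearHorizonData d S} {E f : S → ℝ} {ς : SmoothVectorField d S} {Q P : ℝ → ℝ}

theorem normSqDiff_pos {p : S} (h : mvfderiv (𝓡 d) f p ≠ 0) : 0 < D.normSqDiff f p := by
  rw [normSqDiff, ← D.inner_grad]
  apply D.γ.pos
  intro h0
  apply h
  ext v
  rw [← D.inner_grad, h0]
  simp

theorem IsKilling.add {ς₁ ς₂ : SmoothVectorField d S} (h₁ : D.IsKilling ς₁) (h₂ : D.IsKilling ς₂) :
    D.IsKilling (ς₁ + ς₂) := by
  intro p X Y hX hY
  have : IsManifold (𝓡 d) 2 S := IsManifold.of_le (n := ∞) (by norm_cast)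
  have hd₁ := (ς₁.contMDiff p).mdifferentiableAt (by simp)
  have hd₂ := (ς₂.contMDiff p).mdifferentiableAt (by simp)
  have e₁ := h₁ p X Y hX hY
  have e₂ := h₂ p X Y hX hY
  have hadd : (fun q => (ς₁ + ς₂) q) = (fun q => ς₁ q) + fun q => ς₂ q := rfl
  rw [lieDerivMetric] at e₁ e₂ ⊢
  rw [hadd, VectorField.mlieBracket_add_left hd₁ hd₂, VectorField.mlieBracket_add_left hd₁ hd₂,
    ContMDiffSection.coe_add, Pi.add_apply]
  simp only [map_add, add_apply]
  linear_combination e₁ + e₂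

theorem IsKilling.smul (k : ℝ) (h : D.IsKilling ς) : D.IsKilling (k • ς) := by
  intro p X Y hX hY
  have : IsManifold (𝓡 d) 2 S := IsManifold.of_le (n := ∞) (by norm_cast)
  have hd := (ς.contMDiff p).mdifferentiableAt (by simp)
  have e := h p X Y hX hY
  have hsmul : (fun q => (k • ς) q) = k • fun q => ς q := rfl
  rw [lieDerivMetric] at e ⊢
  rw [hsmul, VectorField.mlieBracket_const_smul_left hd, VectorField.mlieBracket_const_smul_left hd,
    ContMDiffSection.coe_smul, Pi.smul_apply]
  simp only [map_smul, smul_apply, smul_eq_mul]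
  linear_combination k * e

theorem isKilling_zero : D.IsKilling (0 : SmoothVectorField d S) := by
  intro p X Y _ _
  have hzero : (fun q => (0 : SmoothVectorField d S) q) = 0 := rfl
  rw [lieDerivMetric, hzero]
  simp

/-- The adapted vector fields form a linear subspace. -/
def adaptedSubmodule (D : NearHorizonData d S) (E : S → ℝ) (c : ℝ) :
    Submodule ℝ (SmoothVectorField d S) where
  carrier := {ς | D.IsAdapted E c ς}
  zero_mem' := by
    refine ⟨isKilling_zero, fun _ => 0, 0, ⟨contMDiff_const, fun p => ?_⟩, fun p => ?_⟩
    · rw [mvfderiv_const]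
      ext v
      simp [lower]
    · simp
  add_mem' := by
    rintro ς₁ ς₂ ⟨hK₁, g₁, b₁, hg₁, hs₁⟩ ⟨hK₂, g₂, b₂, hg₂, hs₂⟩
    refine ⟨hK₁.add hK₂, fun p => g₁ p + g₂ p, b₁ + b₂, ⟨hg₁.smooth.add hg₂.smooth, fun p => ?_⟩,
      fun p => ?_⟩
    · rw [mvfderiv_fun_add (hg₁.smooth.mdifferentiable (by simp) p)
        (hg₂.smooth.mdifferentiable (by simp) p), hg₁.deriv_eq, hg₂.deriv_eq, ← smul_add]
      simp [lower]
    · rw [ContMDiffSection.coe_add, Pi.add_apply, map_add, hs₁, hs₂]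
      ring
  smul_mem' := by
    rintro k ς ⟨hK, g, b, hg, hs⟩
    refine ⟨hK.smul k, fun p => k * g p, k * b, ⟨contMDiff_const.mul hg.smooth, fun p => ?_⟩,
      fun p => ?_⟩
    · rw [mvfderiv_fun_mul mdifferentiableAt_const (hg.smooth.mdifferentiable (by simp) p),
        mvfderiv_const, smul_zero, add_zero, hg.deriv_eq, smul_comm]
      simp [lower]
    · rw [ContMDiffSection.coe_smul, Pi.smul_apply, map_smul, hs, smul_eq_mul]
      ring

/-! ### From a potential to an adapted field -/

namespace Represents

theorem mvfderiv_apply_self (h : D.Represents ς f Q P) (p : S) :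
    mvfderiv (𝓡 d) f p (ς p) = Q (f p) := by
  have hN := (D.normSqDiff_pos (h.df_ne_zero p)).ne'
  rw [← D.inner_grad, D.γ.symm]
  change D.lower ς p (D.grad f p) = _
  rw [h.form_eq]
  change Q (f p) / D.normSqDiff f p * D.normSqDiff f p = _
  field_simp

theorem isOpen_range (h : D.Represents ς f Q P) : IsOpen (range f) :=
  isOpen_range_of_mvfderiv_ne_zero h.smooth_f h.df_ne_zero

theorem contMDiff_comp (h : D.Represents ς f Q P) {k : ℝ → ℝ} (hk : ContDiffOn ℝ ∞ k (range f)) :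
    ContMDiff (𝓡 d) 𝓘(ℝ, ℝ) ∞ fun p => k (f p) := fun p =>
  ContMDiffAt.comp p (hk.contDiffAt (h.isOpen_range.mem_nhds ⟨p, rfl⟩)).contMDiffAt (h.smooth_f p)

theorem contDiffOn_deriv_add_sq (h : D.Represents ς f Q P) :
    ContDiffOn ℝ ∞ (fun t => deriv P t + P t ^ 2) (range f) :=
  (h.smooth_P.deriv_of_isOpen h.isOpen_range (by simp)).add (h.smooth_P.pow 2)

theorem mvfderiv_comp (h : D.Represents ς f Q P) {k : ℝ → ℝ} {k' : ℝ} {p : S}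
    (hk : HasDerivAt k k' (f p)) :
    mvfderiv (𝓡 d) (fun q => k (f q)) p = k' • mvfderiv (𝓡 d) f p :=
  mvfderiv_comp_of_hasDerivAt (h.smooth_f.mdifferentiable (by simp) p) hk

theorem hasDerivAt_Q (h : D.Represents ς f Q P) (p : S) :
    HasDerivAt Q (Q (f p) * P (f p)) (f p) := by
  rw [← h.ode_Q _ ⟨p, rfl⟩]
  exact ((h.smooth_Q.differentiableOn (by simp)).differentiableAt
    (h.isOpen_range.mem_nhds ⟨p, rfl⟩)).hasDerivAt

variable [ConnectedSpace S]

theorem Q_apply_ne_zero (h : D.Represents ς f Q P) (p : S) : Q (f p) ≠ 0 :=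
  ne_zero_of_deriv_eq_mul h.isOpen_range (isPreconnected_range h.smooth_f.continuous)
    (h.smooth_Q.differentiableOn (by simp)) h.smooth_P.continuousOn h.Q_ne_zero h.ode_Q ⟨p, rfl⟩

theorem isIntegratingFactor (h : D.Represents ς f Q P) :
    D.IsIntegratingFactor fun p => D.normSqDiff f p / Q (f p) := by
  have hN := fun p => (D.normSqDiff_pos (h.df_ne_zero p)).ne'
  have hQ := h.Q_apply_ne_zero
  have hQs := h.contMDiff_comp h.smooth_Q
  have hl : ∀ p, D.lower ς p (ς p) = Q (f p) ^ 2 / D.normSqDiff f p := by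
    intro p
    rw [h.form_eq]
    change Q (f p) / D.normSqDiff f p * mvfderiv (𝓡 d) f p (ς p) = _
    rw [h.mvfderiv_apply_self]
    ring
  -- The gradient is defined pointwise, so smoothness of `N` is not immediate. It is avoided by
  -- writing `E` through the smooth function `γ(ς, ς) = Q² / N`.
  have hE : (fun p => D.normSqDiff f p / Q (f p)) = fun p => Q (f p) / D.lower ς p (ς p) := by
    funext p
    rw [hl]
    have := hQ p
    field_simp
  have hs : ContMDiff (𝓡 d) 𝓘(ℝ, ℝ) ∞ fun p => D.normSqDiff f p / Q (f p) := by
    rw [hE]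
    refine hQs.div₀ (D.contMDiff_lower_self ς) fun p => ?_
    rw [hl]
    exact div_ne_zero (pow_ne_zero 2 (hQ p)) (hN p)
  refine ⟨hs, fun p => div_ne_zero (hN p) (hQ p), fun p => ?_⟩
  -- From `N = Q E` and `Q' = Q P`, `dN / N = P df + dE / E`; the `P df` terms cancel in the formula
  -- for `s`.
  have hNE : D.normSqDiff f = fun p => Q (f p) * (D.normSqDiff f p / Q (f p)) := by
    funext p
    have := hQ p
    field_simp
  have hdN := mvfderiv_fun_mul (hQs.mdifferentiable (by simp) p) (hs.mdifferentiable (by simp) p)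
  rw [← hNE, h.mvfderiv_comp (h.hasDerivAt_Q p)] at hdN
  ext v
  rw [h.s_eq, hdN]
  have := hQ p
  have := hN p
  simp
  field_simp
  ring

theorem isPrimitive (h : D.Represents ς f Q P) :
    D.IsPrimitive (fun p => D.normSqDiff f p / Q (f p)) ς f := by
  refine ⟨h.smooth_f, fun p => ?_⟩
  rw [h.form_eq, smul_smul]
  have := h.Q_apply_ne_zero p
  have := (D.normSqDiff_pos (h.df_ne_zero p)).ne'
  rw [div_mul_div_cancel₀ (by assumption), div_self (by assumption), one_smul]

/-- Since `df(ς) = Q(f)`, the identity `d(df(ς)) = 2 s(ς) df` reads `Q P df = 2 s(ς) df`, and `df`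
can be cancelled. -/
theorem s_apply (h : D.Represents ς f Q P) (hK : D.IsKilling ς) (p : S) :
    D.s p (ς p) = Q (f p) * P (f p) / 2 := by
  obtain ⟨v, hv⟩ : ∃ v, mvfderiv (𝓡 d) f p v ≠ 0 := by
    by_contra! hall
    exact h.df_ne_zero p (ContinuousLinearMap.ext hall)
  have h1 := h.isPrimitive.mvfderiv_apply_self h.isIntegratingFactor hK p v
  have h2 : (fun q => mvfderiv (𝓡 d) f q (ς q)) = fun q => Q (f q) :=
    funext h.mvfderiv_apply_self
  rw [h2, h.mvfderiv_comp (h.hasDerivAt_Q p)] at h1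
  have h3 := mul_right_cancel₀ hv h1
  linear_combination (-1 / 2 : ℝ) * h3

theorem exists_h_eq_and_isAdapted (h : D.Represents ς f Q P) (hK : D.IsKilling ς) :
    ∃ c : ℝ, (∀ p, D.h p = c * (D.normSqDiff f p / Q (f p))) ∧
      D.IsAdapted (fun p => D.normSqDiff f p / Q (f p)) c ς := by
  obtain ⟨p₀⟩ := (inferInstance : Nonempty S)
  have hR := h.contDiffOn_deriv_add_sq
  have hk : ContDiffOn ℝ ∞ (fun t => Q t * (deriv P t + P t ^ 2) / 2) (range f) :=
    (h.smooth_Q.mul hR).div_const 2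
  have hdP : ∀ p, HasDerivAt P (deriv P (f p)) (f p) := fun p =>
    ((h.smooth_P.differentiableOn (by simp)).differentiableAt
      (h.isOpen_range.mem_nhds ⟨p, rfl⟩)).hasDerivAt
  have hdR : ∀ p, HasDerivAt (fun t => deriv P t + P t ^ 2)
      (-(P (f p) * (deriv P (f p) + P (f p) ^ 2))) (f p) := by
    intro p
    rw [← eq_neg_of_add_eq_zero_left (h.ode_P _ ⟨p, rfl⟩)]
    exact ((hR.differentiableOn (by simp)).differentiableAt
      (h.isOpen_range.mem_nhds ⟨p, rfl⟩)).hasDerivAt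
  -- With `R = P' + P²`, the equations `Q' = Q P` and `R' = -P R` give `(Q R)' = 0`.
  have hconst := eq_of_mvfderiv_eq_zero (h.contMDiff_comp hk) (fun p => by
    refine (h.mvfderiv_comp (((h.hasDerivAt_Q p).mul (hdR p)).div_const 2)).trans ?_
    convert! zero_smul ℝ _ using 2
    ring)
  set c := Q (f p₀) * (deriv P (f p₀) + P (f p₀) ^ 2) / 2 with hc
  have hk' : ContDiffOn ℝ ∞ (fun t => Q t * P t / 2 - c * t) (range f) :=
    ((h.smooth_Q.mul h.smooth_P).div_const 2).sub (contDiffOn_const.mul contDiffOn_id)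
  -- Here `(Q P / 2)' = Q (P' + P²) / 2 = c`.
  have hconst' := eq_of_mvfderiv_eq_zero (h.contMDiff_comp hk') (fun p => by
    refine (h.mvfderiv_comp ((((h.hasDerivAt_Q p).mul (hdP p)).div_const 2).sub
      ((hasDerivAt_id (f p)).const_mul c))).trans ?_
    convert! zero_smul ℝ _ using 2
    rw [hc, hconst p₀ p]
    ring)
  refine ⟨c, fun p => ?_, hK, f, Q (f p₀) * P (f p₀) / 2 - c * f p₀, h.isPrimitive, fun p => ?_⟩
  · rw [h.h_eq, hc, hconst p₀ p]
    have := h.Q_apply_ne_zero p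
    field_simp
  · rw [h.s_apply hK]
    linear_combination hconst' p p₀

end Represents

/-! ### From an adapted field to a potential -/

variable [ConnectedSpace S]

/-- Both have logarithmic derivative `2 s`, so their quotient has zero differential. -/
theorem IsIntegratingFactor.exists_eq_mul {E₁ E₂ : S → ℝ} (h₁ : D.IsIntegratingFactor E₁)
    (h₂ : D.IsIntegratingFactor E₂) : ∃ k : ℝ, k ≠ 0 ∧ ∀ p, E₂ p = k * E₁ p := by
  obtain ⟨p₀⟩ := (inferInstance : Nonempty S)
  have hs : ContMDiff (𝓡 d) 𝓘(ℝ, ℝ) ∞ fun p => E₂ p / E₁ p :=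
    h₂.smooth.div₀ h₁.smooth h₁.ne_zero
  have hE : E₂ = fun p => E₂ p / E₁ p * E₁ p := by
    funext p
    rw [div_mul_cancel₀ _ (h₁.ne_zero p)]
  have hconst := eq_of_mvfderiv_eq_zero hs (fun p => by
    have h := mvfderiv_fun_mul (hs.mdifferentiable (by simp) p)
      (h₁.smooth.mdifferentiable (by simp) p)
    rw [← hE, h₁.deriv_eq, h₂.deriv_eq, smul_smul] at h
    have h3 : E₂ p / E₁ p * (2 * E₁ p) = 2 * E₂ p := by
      have := h₁.ne_zero p
      field_simp
    rw [h3] at h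
    exact (smul_eq_zero.1 (left_eq_add.1 h)).resolve_left (h₁.ne_zero p))
  refine ⟨E₂ p₀ / E₁ p₀, div_ne_zero (h₂.ne_zero _) (h₁.ne_zero _), fun p => ?_⟩
  rw [hconst p₀ p, div_mul_cancel₀ _ (h₁.ne_zero p)]

/-- This lets fields with different potentials share one linear space. If `E₂ = k E₁`, the primitive
rescales to `g / k`, and the common `h` forces `c₁ = c₂ k`, so that `c₂ g = c₁ (g / k)`. -/
theorem IsAdapted.of_integratingFactor {E₁ E₂ : S → ℝ} {c₁ c₂ : ℝ}
    (h₁ : D.IsIntegratingFactor E₁) (h₂ : D.IsIntegratingFactor E₂)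
    (hc₁ : ∀ p, D.h p = c₁ * E₁ p) (hc₂ : ∀ p, D.h p = c₂ * E₂ p) (h : D.IsAdapted E₂ c₂ ς) :
    D.IsAdapted E₁ c₁ ς := by
  obtain ⟨k, hk, hE⟩ := h₁.exists_eq_mul h₂
  obtain ⟨hK, g, b, hg, hs⟩ := h
  refine ⟨hK, fun p => k⁻¹ * g p, b, ⟨contMDiff_const.mul hg.smooth, fun p => ?_⟩, fun p => ?_⟩
  · rw [mvfderiv_fun_mul mdifferentiableAt_const (hg.smooth.mdifferentiable (by simp) p),
      mvfderiv_const, hg.deriv_eq, hE, smul_zero, add_zero, smul_smul, inv_mul_cancel_left₀ hk]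
  · have hc : c₁ = c₂ * k := by
      apply mul_right_cancel₀ (h₁.ne_zero p)
      rw [mul_assoc, ← hE, ← hc₁, hc₂]
    rw [hs, hc]
    field_simp

/-- A nonzero adapted vector field has a potential. -/
theorem IsAdapted.exists_isPotential {c : ℝ} (hE : D.IsIntegratingFactor E)
    (hc : ∀ p, D.h p = c * E p) (h : D.IsAdapted E c ς) (hne : ς ≠ 0) :
    ∃ f, D.IsPotential ς f := by
  have hς : ∀ p, ς p ≠ 0 := fun p hp => hne (h.eq_zero_of_apply_eq_zero hE hp)
  obtain ⟨hK, g, b, hg, hs⟩ := h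
  obtain ⟨a, ha⟩ := hg.exists_quadratic hE hK hs
  have hgrad : ∀ p, D.grad g p = E p • ς p := by
    intro p
    have h : ∀ w, D.bilin p (D.grad g p - E p • ς p) w = 0 := by
      intro w
      rw [map_sub, map_smul, LinearMap.sub_apply, LinearMap.smul_apply]
      change D.γ.inner p (D.grad g p) w - E p • D.lower ς p w = 0
      rw [D.inner_grad, hg.mvfderiv_apply, smul_eq_mul, sub_self]
    exact sub_eq_zero.1 ((D.bilin_nondegenerate p).1 _ h)
  obtain ⟨Q, hQdef⟩ : ∃ Q : ℝ → ℝ, Q = fun t => c * t ^ 2 + 2 * b * t + a := ⟨_, rfl⟩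
  have haQ : ∀ p, mvfderiv (𝓡 d) g p (ς p) = Q (g p) := fun p => by rw [ha, hQdef]
  have hN : D.normSqDiff g = fun p => E p * Q (g p) := by
    funext p
    rw [normSqDiff, hgrad, map_smul, haQ, smul_eq_mul]
  have hQ : ∀ p, Q (g p) ≠ 0 := by
    intro p
    rw [← haQ, hg.mvfderiv_apply]
    exact mul_ne_zero (hE.ne_zero p) (D.γ.pos p _ (hς p)).ne'
  have hdQ : ∀ t, HasDerivAt Q (2 * c * t + 2 * b) t := by
    intro t
    rw [hQdef]
    convert! (((hasDerivAt_id t).pow 2).const_mul c |>.add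
      ((hasDerivAt_id t).const_mul (2 * b))).add_const a using 1
    simp
    ring
  have hdQ' : ∀ t, HasDerivAt (fun t => 2 * c * t + 2 * b) (2 * c) t := by
    intro t
    simpa using ((hasDerivAt_id t).const_mul (2 * c)).add_const (2 * b)
  -- For `P = Q' / Q`, `P' + P² = Q'' / Q`, and `Q'' = 2 c`.
  have hR : ∀ t, Q t ≠ 0 → deriv (fun t => (2 * c * t + 2 * b) / Q t) t +
      ((2 * c * t + 2 * b) / Q t) ^ 2 = 2 * c / Q t := by
    intro t ht
    rw [((hdQ' t).fun_div (hdQ t) ht).deriv]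
    field_simp
    ring
  have hsQ : ContDiff ℝ ∞ Q := by
    rw [hQdef]
    fun_prop
  refine ⟨g, Q, fun t => (2 * c * t + 2 * b) / Q t, ?_⟩
  constructor
  · exact hg.smooth
  · intro p h0
    apply hQ p
    rw [← haQ, h0, zero_apply]
  · exact hsQ.contDiffOn
  · refine ContDiffOn.div (by fun_prop) hsQ.contDiffOn ?_
    rintro _ ⟨p, rfl⟩
    exact hQ p
  · obtain ⟨p⟩ := (inferInstance : Nonempty S)
    exact ⟨g p, ⟨p, rfl⟩, hQ p⟩
  · rintro _ ⟨p, rfl⟩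
    rw [(hdQ _).deriv, mul_div_cancel₀ _ (hQ p)]
  · rintro _ ⟨p, rfl⟩
    -- The formula `2 c / Q` is available only where `Q ≠ 0`; a neighbourhood of `g p` suffices to
    -- differentiate it.
    have hev : (fun x => deriv (fun t => (2 * c * t + 2 * b) / Q t) x +
        ((2 * c * x + 2 * b) / Q x) ^ 2) =ᶠ[𝓝 (g p)] fun t => 2 * c / Q t := by
      filter_upwards [hsQ.continuous.continuousAt.eventually_ne (hQ p)] with t ht using hR t ht
    rw [hev.deriv_eq, hR _ (hQ p),
      ((hasDerivAt_const (g p) (2 * c)).fun_div (hdQ (g p)) (hQ p)).deriv]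
    have := hQ p
    field_simp
    ring
  · intro p
    have h1 := hQ p
    have h2 := hE.ne_zero p
    have h3 : Q (g p) / (E p * Q (g p)) * E p = 1 := by field_simp
    rw [hN, hg.deriv_eq, smul_smul, h3, one_smul]
  · intro p
    have hgd := hg.smooth.mdifferentiable (by simp) p
    have hQd : MDifferentiableAt (𝓡 d) 𝓘(ℝ, ℝ) (fun q => Q (g q)) p :=
      (hsQ.contMDiff.comp hg.smooth).mdifferentiable (by simp) p
    rw [hN, mvfderiv_fun_mul (hE.smooth.mdifferentiable (by simp) p) hQd, hE.deriv_eq,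
      mvfderiv_comp_of_hasDerivAt hgd (hdQ (g p))]
    have h1 := hQ p
    have h2 := hE.ne_zero p
    ext v
    simp
    field_simp
    ring
  · intro p
    have h1 := hQ p
    rw [hR _ h1, hN, hc]
    field_simp

/-- If some Killing field has a potential, then `killingCollection` is the space of adapted
vector fields. -/
theorem Represents.coe_adaptedSubmodule {f : S → ℝ} (h : D.Represents ς f Q P) {c : ℝ}
    (hc : ∀ p, D.h p = c * (D.normSqDiff f p / Q (f p))) :
    (D.adaptedSubmodule (fun p => D.normSqDiff f p / Q (f p)) c : Set (SmoothVectorField d S)) =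
      D.killingCollection := by
  ext ς'
  constructor
  · intro h'
    by_cases h0 : ς' = 0
    · exact ⟨h'.1, Or.inl h0⟩
    · exact ⟨h'.1, Or.inr (IsAdapted.exists_isPotential h.isIntegratingFactor hc h' h0)⟩
  · rintro ⟨hK, rfl | ⟨f', Q', P', h'⟩⟩
    · exact Submodule.zero_mem _
    · obtain ⟨c', hc', had⟩ := h'.exists_h_eq_and_isAdapted hK
      exact had.of_integratingFactor h.isIntegratingFactor h'.isIntegratingFactor hc hc'

end NearHorizonData
end

/-! ### Linearity, hypersurface-orthogonality and independence of differentials -/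

section
variable {d : ℕ} {S : Type*} [TopologicalSpace S]
  [ChartedSpace (EuclideanSpace ℝ (Fin d)) S] [IsManifold (𝓡 d) ∞ S] [ConnectedSpace S]

namespace NearHorizonData

theorem exists_submodule_eq_killingCollection (D : NearHorizonData d S) :
    ∃ V : Submodule ℝ (SmoothVectorField d S),
      (V : Set (SmoothVectorField d S)) = D.killingCollection := by
  -- One Killing field with a potential supplies the reference `E` and `c`; without one the
  -- collection is zero.
  by_cases h : ∃ ς f, D.IsKilling ς ∧ D.IsPotential ς f
  · obtain ⟨ς, f, hK, Q, P, hr⟩ := h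
    obtain ⟨c, hc, -⟩ := hr.exists_h_eq_and_isAdapted hK
    exact ⟨_, hr.coe_adaptedSubmodule hc⟩
  · refine ⟨⊥, ?_⟩
    ext ς
    rw [SetLike.mem_coe, Submodule.mem_bot]
    constructor
    · rintro rfl
      exact ⟨isKilling_zero, Or.inl rfl⟩
    · rintro ⟨hK, h0 | ⟨f, hf⟩⟩
      · exact h0
      · exact absurd ⟨ς, f, hK, hf⟩ h

theorem isHypersurfaceOrthogonal_of_mem {D : NearHorizonData d S} {ς : SmoothVectorField d S}
    (h : ς ∈ D.killingCollection) : D.IsHypersurfaceOrthogonal ς := by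
  obtain ⟨hK, rfl | ⟨f, Q, P, hr⟩⟩ := h
  · intro p X Y W _ _ _
    simp [lower]
  · exact hr.isPrimitive.isHypersurfaceOrthogonal hr.isIntegratingFactor

/-- Linearly independent members of `killingCollection` have independent differentials of
potentials at every point. -/
theorem wedgeCovectors_ne_zero {D : NearHorizonData d S} {ς₁ ς₂ : SmoothVectorField d S}
    (h₁ : ς₁ ∈ D.killingCollection) (h₂ : ς₂ ∈ D.killingCollection)
    (hli : LinearIndependent ℝ ![ς₁, ς₂]) {f₁ f₂ : S → ℝ} (hf₁ : D.IsPotential ς₁ f₁)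
    (hf₂ : D.IsPotential ς₂ f₂) (p : S) :
    wedgeCovectors (mvfderiv (𝓡 d) f₁ p) (mvfderiv (𝓡 d) f₂ p) ≠ 0 := by
  intro hw
  obtain ⟨Q₁, P₁, hr₁⟩ := hf₁
  obtain ⟨Q₂, P₂, hr₂⟩ := hf₂
  obtain ⟨c, hc, -⟩ := hr₁.exists_h_eq_and_isAdapted h₁.1
  have hV := hr₁.coe_adaptedSubmodule hc
  obtain ⟨v, hv⟩ : ∃ v, mvfderiv (𝓡 d) f₁ p v ≠ 0 := by
    by_contra! hall
    exact hr₁.df_ne_zero p (ContinuousLinearMap.ext hall)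
  -- Contracting `df₁ ∧ df₂ = 0` with `v` gives `df₁(v) df₂ = df₂(v) df₁` at `p`; substituting `dfᵢ
  -- = Eᵢ γ(ςᵢ, ·)` yields the coefficients.
  obtain ⟨k₁, k₂, hk, hlow⟩ : ∃ k₁ k₂ : ℝ, k₁ ≠ 0 ∧
      k₁ • D.lower ς₂ p - k₂ • D.lower ς₁ p = 0 := by
    have hE₁ := hr₁.isIntegratingFactor.ne_zero p
    have hE₂ := hr₂.isIntegratingFactor.ne_zero p
    refine ⟨mvfderiv (𝓡 d) f₁ p v * (D.normSqDiff f₂ p / Q₂ (f₂ p)),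
      mvfderiv (𝓡 d) f₂ p v * (D.normSqDiff f₁ p / Q₁ (f₁ p)), mul_ne_zero hv hE₂, ?_⟩
    rw [mul_smul, mul_smul, ← hr₁.isPrimitive.deriv_eq, ← hr₂.isPrimitive.deriv_eq]
    ext w
    have := congrFun (congrFun hw v) w
    simp only [wedgeCovectors, Pi.zero_apply] at this
    simp only [sub_apply, smul_apply, smul_eq_mul, zero_apply]
    linear_combination this
  have hmem : k₁ • ς₂ - k₂ • ς₁ ∈
      D.adaptedSubmodule (fun p => D.normSqDiff f₁ p / Q₁ (f₁ p)) c :=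
    Submodule.sub_mem _ (Submodule.smul_mem _ _ (hV.symm ▸ h₂ : ς₂ ∈ (_ : Set _)))
      (Submodule.smul_mem _ _ (hV.symm ▸ h₁ : ς₁ ∈ (_ : Set _)))
  have hp : (k₁ • ς₂ - k₂ • ς₁) p = 0 := by
    apply D.eq_zero_of_lower_eq_zero
    rw [← hlow]
    simp [lower]
  -- The combination is adapted by linearity, so its vanishing at `p` propagates to all of `S`.
  have h0 := IsAdapted.eq_zero_of_apply_eq_zero hr₁.isIntegratingFactor hmem hp
  have := LinearIndependent.pair_iff.1 hli (-k₂) k₁ (by rw [← h0]; module)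
  exact hk this.2

end NearHorizonData

end

theorem mainTheorem10 (d : ℕ) (S : Type*) [TopologicalSpace S] [T2Space S]
    [SecondCountableTopology S] [ConnectedSpace S]
    [ChartedSpace (EuclideanSpace ℝ (Fin d)) S] [IsManifold (𝓡 d) ∞ S]
    (D : NearHorizonData d S) :
    (∃ V : Submodule ℝ (SmoothVectorField d S),
      (V : Set (SmoothVectorField d S)) = D.killingCollection) ∧
    (∀ ς ∈ D.killingCollection, D.IsKilling ς ∧ D.IsHypersurfaceOrthogonal ς) ∧
    (∀ ς₁ ∈ D.killingCollection, ∀ ς₂ ∈ D.killingCollection,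
      LinearIndependent ℝ ![ς₁, ς₂] →
      (∃ f₁ f₂ : S → ℝ, D.IsPotential ς₁ f₁ ∧ D.IsPotential ς₂ f₂) ∧
      ∀ f₁ f₂ : S → ℝ, D.IsPotential ς₁ f₁ → D.IsPotential ς₂ f₂ →
        ∀ p : S, wedgeCovectors (mvfderiv (𝓡 d) f₁ p) (mvfderiv (𝓡 d) f₂ p) ≠ 0) := by
  refine ⟨D.exists_submodule_eq_killingCollection,
    fun ς h => ⟨h.1, NearHorizonData.isHypersurfaceOrthogonal_of_mem h⟩,
    fun ς₁ h₁ ς₂ h₂ hli => ⟨?_, fun f₁ f₂ hf₁ hf₂ p =>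
      NearHorizonData.wedgeCovectors_ne_zero h₁ h₂ hli hf₁ hf₂ p⟩⟩
  obtain ⟨f₁, hf₁⟩ := h₁.2.resolve_left (hli.ne_zero 0)
  obtain ⟨f₂, hf₂⟩ := h₂.2.resolve_left (hli.ne_zero 1)
  exact ⟨f₁, f₂, hf₁, hf₂⟩
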